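/- Let $N\ge 1$ be an integer and $p\in(1,3+\frac4N)$. Let $$\mathcal X=\Big\{u\in W^{1,2}(\mathbb R^N;\mathbb R):\ \int_{\mathbb R^N}|u|^2|\nabla u|^2\,dx<\infty\Big\},\qquad S(c)=\Big\{u\in\mathcal X:\ \int_{\mathbb R^N}|u|^2\,dx=c\Big\}\quad(c>0),$$ $$J(u)=\frac12\int_{\mathbb R^N}|\nabla u|^2dx+\int_{\mathbb R^N}|u|^2|\nabla u|^2dx-\frac1{p+1}\int_{\mathbb R^N}|u|^{p+1}dx .$$ A number $\beta\in\mathbb R$ is called a Lagrange multiplier of $v\in S(c)$ if $(v,\beta)$ solves $-\Delta v-v\Delta(|v|^2)-\beta v-|v|^{p-1}v=0$ weakly in $\mathbb R^N$, that is, if for every $\phi\in C_0^\infty(\mathbb R^N;\mathbb R)$ $$\int_{\mathbb R^N}\nabla v\cdot\nabla\phi\,dx+2\int_{\mathbb R^N}\big(v\phi|\nabla v|^2+|v|^2\nabla v\cdot\nabla\phi\big)dx-\beta\int_{\mathbb R^N}v\phi\,dx-\int_{\mathbb R^N}|v|^{p-1}v\phi\,dx=0 .$$ Then the Lagrange multipliers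 $\beta_c$ of the global minimizers $v_c$ of $J$ on $S(c)$ satisfy $\beta_c\to-\infty$ as $c\to\infty$, uniformly in the choice of $v_c$: for every $M\in\mathbb R$ there is $C>0$ such that, whenever $c\ge C$, $v_c$ is a global minimizer of $J$ on $S(c)$, and $\beta_c$ is a Lagrange multiplier of $v_c$, one has $\beta_c<M$. -/

import Mathlib

open MeasureTheory Filter Topology
open scoped ContDiff

namespace QuasilinearSchrodinger

/-- `φ` is a real test function: smooth with compact support on `ℝ^N`. -/
def IsTestFunction {N : ℕ} (φ : EuclideanSpace ℝ (Fin N) → ℝ) : Prop :=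
  ContDiff ℝ ∞ φ ∧ HasCompactSupport φ

/-- `G` is a weak (distributional) gradient of `u` on `ℝ^N`. -/
def HasWeakGrad {N : ℕ} (u : EuclideanSpace ℝ (Fin N) → ℝ)
    (G : EuclideanSpace ℝ (Fin N) → EuclideanSpace ℝ (Fin N)) : Prop :=
  LocallyIntegrable u ∧ LocallyIntegrable G ∧
    ∀ φ : EuclideanSpace ℝ (Fin N) → ℝ, IsTestFunction φ →
      ∫ x, u x • gradient φ x = - ∫ x, φ x • G x

open Classical in
/-- The weak gradient of `u`, a chosen representative (it is unique almost everywhere, see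
`HasWeakGrad.weakGrad_ae_eq`); it is `0` by convention if `u` has no weak gradient. -/
noncomputable def weakGrad {N : ℕ} (u : EuclideanSpace ℝ (Fin N) → ℝ) :
    EuclideanSpace ℝ (Fin N) → EuclideanSpace ℝ (Fin N) :=
  if h : ∃ G, HasWeakGrad u G then h.choose else 0

theorem HasWeakGrad.weakGrad {N : ℕ} {u : EuclideanSpace ℝ (Fin N) → ℝ}
    {G : EuclideanSpace ℝ (Fin N) → EuclideanSpace ℝ (Fin N)} (h : HasWeakGrad u G) :
    HasWeakGrad u (weakGrad u) := by
  have h' : ∃ G, HasWeakGrad u G := ⟨G, h⟩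
  rw [QuasilinearSchrodinger.weakGrad, dif_pos h']
  exact h'.choose_spec

theorem HasWeakGrad.weakGrad_ae_eq {N : ℕ} {u : EuclideanSpace ℝ (Fin N) → ℝ}
    {G : EuclideanSpace ℝ (Fin N) → EuclideanSpace ℝ (Fin N)} (h : HasWeakGrad u G) :
    QuasilinearSchrodinger.weakGrad u =ᵐ[volume] G := by
  refine ae_eq_of_integral_contDiff_smul_eq h.weakGrad.2.1 h.2.1 fun φ hφ hφ' => ?_
  have h1 := h.weakGrad.2.2 φ ⟨hφ, hφ'⟩
  have h2 := h.2.2 φ ⟨hφ, hφ'⟩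
  exact neg_injective (h1.symm.trans h2)

/-- The (real) Sobolev space `W^{1,2}(ℝ^N)`. -/
def SobolevW12 (N : ℕ) : Set (EuclideanSpace ℝ (Fin N) → ℝ) :=
  {u | MemLp u 2 ∧ (∃ G, HasWeakGrad u G) ∧ MemLp (weakGrad u) 2}

/-- The natural space `𝒳 = {u ∈ W^{1,2}(ℝ^N) : ∫ |u|² |∇u|² < ∞}`. -/
def spaceX (N : ℕ) : Set (EuclideanSpace ℝ (Fin N) → ℝ) :=
  {u | u ∈ SobolevW12 N ∧ Integrable fun x => |u x| ^ 2 * ‖weakGrad u x‖ ^ 2}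

/-- The constraint `S(c) = {u ∈ 𝒳 : ∫ |u|² = c}`. -/
def massSphere (N : ℕ) (c : ℝ) : Set (EuclideanSpace ℝ (Fin N) → ℝ) :=
  {u | u ∈ spaceX N ∧ ∫ x, |u x| ^ 2 = c}

/-- The energy
`J(u) = 1/2 ∫ |∇u|² + ∫ |u|² |∇u|² - 1/(p+1) ∫ |u|^(p+1)`. -/
noncomputable def energy {N : ℕ} (p : ℝ) (u : EuclideanSpace ℝ (Fin N) → ℝ) : ℝ :=
  1 / 2 * (∫ x, ‖weakGrad u x‖ ^ 2) + (∫ x, |u x| ^ 2 * ‖weakGrad u x‖ ^ 2)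
    - 1 / (p + 1) * ∫ x, |u x| ^ (p + 1)

/-- `v` is a global minimum of `J` on `S(c)`: `v ∈ S(c)` and `J(v) ≤ J(u)` for all `u ∈ S(c)`. -/
def IsGlobalMinimizer {N : ℕ} (p c : ℝ) (v : EuclideanSpace ℝ (Fin N) → ℝ) : Prop :=
  v ∈ massSphere N c ∧ IsMinOn (energy p) (massSphere N c) v

/-- `u ∈ 𝒳` is a weak solution of `-Δu - u Δ(|u|²) - lam u - |u|^(p-1) u = 0` on `ℝ^N`. -/
def IsWeakSolution {N : ℕ} (p lam : ℝ) (u : EuclideanSpace ℝ (Fin N) → ℝ) : Prop :=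
  u ∈ spaceX N ∧ ∀ φ : EuclideanSpace ℝ (Fin N) → ℝ, IsTestFunction φ →
    (∫ x, inner ℝ (weakGrad u x) (gradient φ x))
      + 2 * (∫ x, (u x * φ x * ‖weakGrad u x‖ ^ 2
          + |u x| ^ 2 * inner ℝ (weakGrad u x) (gradient φ x)))
      - lam * (∫ x, u x * φ x)
      - (∫ x, |u x| ^ (p - 1) * u x * φ x) = 0

/-- `β` is a Lagrange multiplier of `v`, as a critical point of `J` on `S(c)`: `v ∈ S(c)` and
`(v, β)` solves the stationary equation weakly. -/
def IsLagrangeMultiplier {N : ℕ} (p c : ℝ) (v : EuclideanSpace ℝ (Fin N) → ℝ) (β : ℝ) : Prop :=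
  v ∈ massSphere N c ∧ IsWeakSolution p β v

end QuasilinearSchrodinger

/-! The proof rests on the inequality `β c ≤ 2 J(v)` for a minimizer `v` (`multiplier_mul_mass_le`),
together with the fact that the minimal energy per unit mass tends to `-∞` (`exists_energy_le_mul`).

For the inequality, perturb `v` to `v + tφ` and restore the mass `c` by a spatial dilation.
Minimality makes `t = 0` critical. The dilation contributes a Pohozaev-type term, and the weak
equation turns the rest into `β ∫ vφ`. Choosing `∫ vφ ≠ 0` yields `β c = 2 J(v) - (4/N)(½∫|∇v|² +
∫|v|²|∇v|²)`.

For the energy, take `R w(x/R)` with `w` a bump. Its mass is of order `R^(N+2)`, its gradient terms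
are at most of that order, and its power term is of order `R^(N+p+1)`, which dominates because `p >
1`. -/

namespace QuasilinearSchrodinger

variable {N : ℕ}

/-! ### Energy in terms of an arbitrary weak gradient -/

/-- `u ∈ 𝒳` with weak gradient `G`. -/
def IsXPair (u : EuclideanSpace ℝ (Fin N) → ℝ)
    (G : EuclideanSpace ℝ (Fin N) → EuclideanSpace ℝ (Fin N)) : Prop :=
  HasWeakGrad u G ∧ MemLp u 2 ∧ MemLp G 2 ∧ Integrable fun x => |u x| ^ 2 * ‖G x‖ ^ 2

theorem IsXPair.mem_spaceX {u : EuclideanSpace ℝ (Fin N) → ℝ}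
    {G : EuclideanSpace ℝ (Fin N) → EuclideanSpace ℝ (Fin N)} (h : IsXPair u G) :
    u ∈ spaceX N := by
  have hG := h.1.weakGrad_ae_eq
  refine ⟨⟨h.2.1, ⟨G, h.1⟩, h.2.2.1.ae_eq hG.symm⟩, h.2.2.2.congr ?_⟩
  filter_upwards [hG] with x hx
  rw [hx]

theorem isXPair_of_mem_spaceX {u : EuclideanSpace ℝ (Fin N) → ℝ} (h : u ∈ spaceX N) :
    IsXPair u (weakGrad u) :=
  ⟨h.1.2.1.choose_spec.weakGrad, h.1.1, h.1.2.2, h.2⟩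

theorem IsXPair.energy_eq {u : EuclideanSpace ℝ (Fin N) → ℝ}
    {G : EuclideanSpace ℝ (Fin N) → EuclideanSpace ℝ (Fin N)} (h : IsXPair u G) (p : ℝ) :
    energy p u = 1 / 2 * (∫ x, ‖G x‖ ^ 2) + (∫ x, |u x| ^ 2 * ‖G x‖ ^ 2)
      - 1 / (p + 1) * ∫ x, |u x| ^ (p + 1) := by
  have hG := h.1.weakGrad_ae_eq
  rw [energy]
  congr 2
  · congr 1
    exact integral_congr_ae (by filter_upwards [hG] with x hx; rw [hx])
  · exact integral_congr_ae (by filter_upwards [hG] with x hx; rw [hx])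

/-! ### Scaling of amplitude and space -/

theorem memLp_comp_smul {F : Type*} [NormedAddCommGroup F]
    {f : EuclideanSpace ℝ (Fin N) → F} {q : ENNReal} (hf : MemLp f q) {r : ℝ} (hr : r ≠ 0) :
    MemLp (fun x => f (r • x)) q := by
  have h1 : MemLp f q (Measure.map (r • ·) (volume : Measure (EuclideanSpace ℝ (Fin N)))) := by
    rw [Measure.map_addHaar_smul _ hr]
    exact hf.smul_measure ENNReal.ofReal_ne_top
  exact ((Homeomorph.smulOfNeZero r hr).measurableEmbedding.memLp_map_measure_iff).1 h1

theorem gradient_comp_smul {φ : EuclideanSpace ℝ (Fin N) → ℝ} (hφ : Differentiable ℝ φ) (r : ℝ)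
    (x : EuclideanSpace ℝ (Fin N)) :
    gradient (fun y => φ (r • y)) x = r • gradient φ (r • x) := by
  apply HasGradientAt.gradient
  rw [hasGradientAt_iff_hasFDerivAt]
  have h1 := (hφ (r • x)).hasGradientAt.hasFDerivAt.comp x ((hasFDerivAt_id x).const_smul r)
  refine h1.congr_fderiv ?_
  ext y
  simp

theorem IsTestFunction.comp_smul {φ : EuclideanSpace ℝ (Fin N) → ℝ} (hφ : IsTestFunction φ)
    {r : ℝ} (hr : r ≠ 0) : IsTestFunction fun x => φ (r • x) :=
  ⟨hφ.1.comp (contDiff_const_smul r), hφ.2.comp_smul hr⟩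

theorem integral_comp_smul_pos {F : Type*} [NormedAddCommGroup F] [NormedSpace ℝ F]
    (f : EuclideanSpace ℝ (Fin N) → F) {r : ℝ} (hr : 0 < r) :
    ∫ x, f (r • x) = (r ^ N)⁻¹ • ∫ x, f x := by
  rw [Measure.integral_comp_smul_of_nonneg _ _ _ (hR := hr.le)]
  simp

theorem IsXPair.dilate {u : EuclideanSpace ℝ (Fin N) → ℝ}
    {G : EuclideanSpace ℝ (Fin N) → EuclideanSpace ℝ (Fin N)} (h : IsXPair u G)
    (s : ℝ) {r : ℝ} (hr : 0 < r) :
    IsXPair (fun x => s * u (r • x)) (fun x => (s * r) • G (r • x)) := by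
  have hu : MemLp (fun x => s * u (r • x)) 2 := (memLp_comp_smul h.2.1 hr.ne').const_mul s
  have hG : MemLp (fun x => (s * r) • G (r • x)) 2 :=
    (memLp_comp_smul h.2.2.1 hr.ne').const_smul (s * r)
  refine ⟨⟨hu.locallyIntegrable (by norm_num), hG.locallyIntegrable (by norm_num),
    fun φ hφ => ?_⟩, hu, hG, ?_⟩
  -- Test the identity for `u` against `φ(r⁻¹ ·)`, then change variables.
  · have hφ' := hφ.comp_smul (inv_ne_zero hr.ne')
    have key := h.1.2.2 _ hφ'
    have e1 := integral_comp_smul_pos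
      (fun x => u x • gradient (fun y => φ (r⁻¹ • y)) x) hr
    have e2 := integral_comp_smul_pos (fun x => φ (r⁻¹ • x) • G x) hr
    simp only [gradient_comp_smul (hφ.1.differentiable (by norm_num)), inv_smul_smul₀ hr.ne'] at e1
    simp only [inv_smul_smul₀ hr.ne'] at e2
    have e3 : ∀ x, (s * u (r • x)) • gradient φ x
        = (s * r) • (u (r • x) • r⁻¹ • gradient φ x) := fun x => by
      simp only [smul_smul]; congr 1; field_simp
    have e4 : ∀ x, φ x • (s * r) • G (r • x) = (s * r) • (φ x • G (r • x)) :=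
      fun x => smul_comm _ _ _
    simp only [e3, e4, integral_smul, e1, e2]
    simp only [gradient_comp_smul (hφ.1.differentiable (by norm_num))] at key
    rw [key, smul_neg, smul_neg]
  · have := (h.2.2.2.comp_smul hr.ne').const_mul (s ^ 2 * (s * r) ^ 2)
    refine this.congr (.of_forall fun x => ?_)
    simp only [abs_mul, norm_smul, mul_pow, sq_abs, Real.norm_eq_abs]
    ring

theorem integral_sq_dilate (u : EuclideanSpace ℝ (Fin N) → ℝ) (s : ℝ) {r : ℝ} (hr : 0 < r) :
    ∫ x, |s * u (r • x)| ^ 2 = (r ^ N)⁻¹ * (s ^ 2 * ∫ x, |u x| ^ 2) := by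
  simp only [abs_mul, mul_pow, integral_const_mul, sq_abs s]
  rw [integral_comp_smul_pos (fun x => |u x| ^ 2) hr, smul_eq_mul]
  ring

theorem IsXPair.energy_dilate {u : EuclideanSpace ℝ (Fin N) → ℝ}
    {G : EuclideanSpace ℝ (Fin N) → EuclideanSpace ℝ (Fin N)} (h : IsXPair u G) (p : ℝ)
    {s : ℝ} (hs : 0 ≤ s) {r : ℝ} (hr : 0 < r) :
    energy p (fun x => s * u (r • x)) = (r ^ N)⁻¹ *
      (s ^ 2 * r ^ 2 * (1 / 2 * ∫ x, ‖G x‖ ^ 2) + s ^ 4 * r ^ 2 * (∫ x, |u x| ^ 2 * ‖G x‖ ^ 2)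
        - s ^ (p + 1) * (1 / (p + 1) * ∫ x, |u x| ^ (p + 1))) := by
  rw [(h.dilate s hr).energy_eq]
  have e1 : ∫ x, ‖(s * r) • G (r • x)‖ ^ 2 = (r ^ N)⁻¹ * (s ^ 2 * r ^ 2 * ∫ x, ‖G x‖ ^ 2) := by
    simp only [norm_smul, mul_pow, integral_const_mul, Real.norm_eq_abs, sq_abs]
    rw [integral_comp_smul_pos (fun x => ‖G x‖ ^ 2) hr, smul_eq_mul]
    ring
  have e2 : ∫ x, |s * u (r • x)| ^ 2 * ‖(s * r) • G (r • x)‖ ^ 2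
      = (r ^ N)⁻¹ * (s ^ 4 * r ^ 2 * ∫ x, |u x| ^ 2 * ‖G x‖ ^ 2) := by
    have : ∀ x, |s * u (r • x)| ^ 2 * ‖(s * r) • G (r • x)‖ ^ 2
        = (s ^ 4 * r ^ 2) * (|u (r • x)| ^ 2 * ‖G (r • x)‖ ^ 2) := fun x => by
      simp only [abs_mul, norm_smul, mul_pow, sq_abs, Real.norm_eq_abs]
      ring
    simp only [this, integral_const_mul]
    rw [integral_comp_smul_pos (fun x => |u x| ^ 2 * ‖G x‖ ^ 2) hr, smul_eq_mul]
    ring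
  have e3 : ∫ x, |s * u (r • x)| ^ (p + 1)
      = (r ^ N)⁻¹ * (s ^ (p + 1) * ∫ x, |u x| ^ (p + 1)) := by
    simp only [abs_mul, abs_of_nonneg hs, Real.mul_rpow hs (abs_nonneg _),
      integral_const_mul]
    rw [integral_comp_smul_pos (fun x => |u x| ^ (p + 1)) hr, smul_eq_mul]
    ring
  rw [e1, e2, e3]
  ring

/-! ### Adding test functions within `𝒳` -/

theorem IsTestFunction.continuous_gradient {φ : EuclideanSpace ℝ (Fin N) → ℝ}
    (hφ : IsTestFunction φ) : Continuous (gradient φ) := by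
  have := hφ.1.continuous_fderiv (by norm_num)
  exact (InnerProductSpace.toDual ℝ _).symm.continuous.comp this

theorem IsTestFunction.hasCompactSupport_gradient {φ : EuclideanSpace ℝ (Fin N) → ℝ}
    (hφ : IsTestFunction φ) : HasCompactSupport (gradient φ) :=
  (hφ.2.fderiv (𝕜 := ℝ)).comp_left (g := (InnerProductSpace.toDual ℝ _).symm) (map_zero _)

theorem IsTestFunction.hasWeakGrad {φ : EuclideanSpace ℝ (Fin N) → ℝ}
    (hφ : IsTestFunction φ) : HasWeakGrad φ (gradient φ) := by
  refine ⟨hφ.1.continuous.locallyIntegrable, hφ.continuous_gradient.locallyIntegrable,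
    fun ψ hψ => ?_⟩
  have i1 : Integrable fun x => φ x • gradient ψ x :=
    (hφ.1.continuous.smul hψ.continuous_gradient).integrable_of_hasCompactSupport hφ.2.smul_right
  have i2 : Integrable fun x => ψ x • gradient φ x :=
    (hψ.1.continuous.smul hφ.continuous_gradient).integrable_of_hasCompactSupport hψ.2.smul_right
  have i3 : Integrable fun x => φ x * ψ x :=
    (hφ.1.continuous.mul hψ.1.continuous).integrable_of_hasCompactSupport hφ.2.mul_right
  refine ext_inner_left ℝ fun y => ?_
  rw [inner_neg_right, ← integral_inner i1, ← integral_inner i2]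
  simp only [inner_smul_right, inner_gradient_right, conj_trivial]
  have j1 := i1.const_inner (𝕜 := ℝ) y
  have j2 := i2.const_inner (𝕜 := ℝ) y
  simp only [inner_smul_right, inner_gradient_right, conj_trivial] at j1 j2
  have := integral_mul_fderiv_eq_neg_fderiv_mul_of_integrable (f := φ) (g := ψ) (v := y)
    (by simpa only [mul_comm] using j2) j1 i3
    (fun x _ => hφ.1.differentiable (by norm_num) x)
    (fun x _ => hψ.1.differentiable (by norm_num) x)
  simpa only [mul_comm] using this

theorem IsTestFunction.isXPair {φ : EuclideanSpace ℝ (Fin N) → ℝ}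
    (hφ : IsTestFunction φ) : IsXPair φ (gradient φ) := by
  refine ⟨hφ.hasWeakGrad, hφ.1.continuous.memLp_of_hasCompactSupport hφ.2,
    hφ.continuous_gradient.memLp_of_hasCompactSupport hφ.hasCompactSupport_gradient, ?_⟩
  have hc : Continuous fun x => |φ x| ^ 2 * ‖gradient φ x‖ ^ 2 :=
    (hφ.1.continuous.abs.pow 2).mul (hφ.continuous_gradient.norm.pow 2)
  refine hc.integrable_of_hasCompactSupport (hφ.2.mono fun x hx => ?_)
  contrapose! hx
  simp only [Function.mem_support, not_not] at hx ⊢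
  simp [hx]

theorem HasWeakGrad.add_smul {u w : EuclideanSpace ℝ (Fin N) → ℝ}
    {G H : EuclideanSpace ℝ (Fin N) → EuclideanSpace ℝ (Fin N)} (h : HasWeakGrad u G)
    (h' : HasWeakGrad w H) (t : ℝ) :
    HasWeakGrad (fun x => u x + t * w x) (fun x => G x + t • H x) := by
  refine ⟨h.1.add (h'.1.smul t), h.2.1.add (h'.2.1.smul t), fun φ hφ => ?_⟩
  have k1 : ∀ {f : EuclideanSpace ℝ (Fin N) → ℝ}, LocallyIntegrable f →
      Integrable fun x => f x • gradient φ x := fun hf =>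
    hf.integrable_smul_right_of_hasCompactSupport hφ.continuous_gradient
      hφ.hasCompactSupport_gradient
  have k2 : ∀ {f : EuclideanSpace ℝ (Fin N) → EuclideanSpace ℝ (Fin N)}, LocallyIntegrable f →
      Integrable fun x => φ x • f x := fun hf =>
    hf.integrable_smul_left_of_hasCompactSupport hφ.1.continuous hφ.2
  simp only [_root_.add_smul, smul_add, mul_smul, smul_comm (φ _) t]
  have k3 : Integrable fun x => t • w x • gradient φ x := (k1 h'.1).smul t
  have k4 : Integrable fun x => t • φ x • H x := (k2 h'.2.1).smul t
  rw [integral_add (k1 h.1) k3, integral_add (k2 h.2.1) k4,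
    integral_smul, integral_smul, h.2.2 φ hφ, h'.2.2 φ hφ, neg_add, smul_neg]

/-! ### Tools for the first variation -/

/-- Tangent-line inequality for the convex function `|·|^q`. Dividing by `|x|^q` reduces it to
Bernoulli for `z / x ≥ -1`; below `-1` the tangent is already nonpositive. -/
theorem rpow_abs_add_ge {q : ℝ} (hq : 1 ≤ q) (x z : ℝ) :
    |x| ^ q + q * (|x| ^ (q - 2) * x * z) ≤ |x + z| ^ q := by
  rcases eq_or_ne x 0 with rfl | hx
  · simp only [abs_zero, Real.zero_rpow (by linarith : q ≠ 0), mul_zero, zero_mul, zero_add]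
    positivity
  have hx' : 0 < |x| := abs_pos.2 hx
  have e : |x + z| ^ q = |x| ^ q * |1 + z / x| ^ q := by
    rw [← Real.mul_rpow hx'.le (abs_nonneg _), ← abs_mul]
    congr 2
    field_simp
  have e2 : |x| ^ (q - 2) * x * z = |x| ^ q * (z / x) := by
    rw [Real.rpow_sub hx', Real.rpow_two, sq_abs]
    field_simp
  have e3 : 1 + q * (z / x) ≤ |1 + z / x| ^ q := by
    rcases le_or_gt (-1) (z / x) with h | h
    · rw [abs_of_nonneg (by linarith)]
      exact one_add_mul_self_le_rpow_one_add h hq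
    · have : 0 ≤ |1 + z / x| ^ q := by positivity
      nlinarith
  rw [e, e2]
  nlinarith [Real.rpow_pos_of_pos hx' q]

/-- The first variation of `∫ ‖f + t g + t² h‖²` at `t = 0`. -/
theorem hasDerivAt_integral_norm_sq {α E : Type*} [MeasurableSpace α] {μ : Measure α}
    [NormedAddCommGroup E] [InnerProductSpace ℝ E] {f g h : α → E}
    (hf : MemLp f 2 μ) (hg : MemLp g 2 μ) (hh : MemLp h 2 μ) :
    HasDerivAt (fun t : ℝ => ∫ x, ‖f x + t • g x + t ^ 2 • h x‖ ^ 2 ∂μ)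
      (2 * ∫ x, inner ℝ (f x) (g x) ∂μ) 0 := by
  -- The integral is the squared norm of a polynomial curve in `L²`, so no differentiation under the
  -- integral sign is needed.
  have e : ∀ t : ℝ, ∫ x, ‖f x + t • g x + t ^ 2 • h x‖ ^ 2 ∂μ
      = ‖hf.toLp + t • hg.toLp + t ^ 2 • hh.toLp‖ ^ 2 := fun t => by
    have ht : MemLp (f + t • g + t ^ 2 • h) 2 μ :=
      (hf.add (hg.const_smul t)).add (hh.const_smul (t ^ 2))
    have : hf.toLp + t • hg.toLp + t ^ 2 • hh.toLp = ht.toLp := rfl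
    rw [this, ← real_inner_self_eq_norm_sq, L2.inner_def]
    refine integral_congr_ae ?_
    filter_upwards [ht.coeFn_toLp] with x hx
    rw [hx, real_inner_self_eq_norm_sq]
    rfl
  have e' : ∫ x, inner ℝ (f x) (g x) ∂μ = inner ℝ hf.toLp hg.toLp := by
    rw [L2.inner_def]
    refine integral_congr_ae ?_
    filter_upwards [hf.coeFn_toLp, hg.coeFn_toLp] with x h1 h2
    rw [h1, h2]
  simp only [e, e']
  have d : HasDerivAt (fun t : ℝ => hf.toLp + t • hg.toLp + t ^ 2 • hh.toLp) hg.toLp 0 := by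
    have d1 := ((hasDerivAt_id (0 : ℝ)).smul_const hg.toLp).const_add hf.toLp
    have d2 := (hasDerivAt_pow 2 (0 : ℝ)).smul_const hh.toLp
    exact (d1.add d2).congr_deriv (by simp)
  exact d.norm_sq.congr_deriv (by simp)

theorem memLp_of_integrable_abs_rpow {u : EuclideanSpace ℝ (Fin N) → ℝ}
    (hu : AEStronglyMeasurable u) {q : ℝ} (hq : 0 < q)
    (h : Integrable fun x => |u x| ^ q) : MemLp u (ENNReal.ofReal q) := by
  rw [← integrable_norm_rpow_iff hu (by simpa using hq) ENNReal.ofReal_ne_top]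
  simpa [ENNReal.toReal_ofReal hq.le] using h

theorem integrable_abs_rpow_of_memLp {u : EuclideanSpace ℝ (Fin N) → ℝ} {q : ℝ} (hq : 0 < q)
    (h : MemLp u (ENNReal.ofReal q)) : Integrable fun x => |u x| ^ q := by
  have := h.integrable_norm_rpow (by simpa using hq) ENNReal.ofReal_ne_top
  simpa [ENNReal.toReal_ofReal hq.le] using this

theorem IsTestFunction.integrable_abs_rpow {φ : EuclideanSpace ℝ (Fin N) → ℝ}
    (hφ : IsTestFunction φ) {q : ℝ} (hq : 0 < q) : Integrable fun x => |φ x| ^ q :=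
  integrable_abs_rpow_of_memLp hq (hφ.1.continuous.memLp_of_hasCompactSupport hφ.2)

theorem rpow_mul_le_add {a b p : ℝ} (ha : 0 ≤ a) (hb : 0 ≤ b) (hp : 0 < p) :
    a ^ p * b ≤ a ^ (p + 1) + b ^ (p + 1) := by
  have e : ∀ {t : ℝ}, 0 ≤ t → t ^ (p + 1) = t ^ p * t := fun ht => by
    rw [Real.rpow_add_of_nonneg ht hp.le zero_le_one, Real.rpow_one]
  have ha' := Real.rpow_nonneg ha (p + 1)
  have hb' := Real.rpow_nonneg hb (p + 1)
  rcases le_total a b with h | h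
  · have := mul_le_mul_of_nonneg_right (Real.rpow_le_rpow ha h hp.le) hb
    rw [← e hb] at this
    linarith
  · have := mul_le_mul_of_nonneg_left h (Real.rpow_nonneg ha p)
    rw [← e ha] at this
    linarith

theorem integrable_rpow_mul_test {u φ : EuclideanSpace ℝ (Fin N) → ℝ}
    (hu : AEStronglyMeasurable u) {p : ℝ} (hp : 1 < p)
    (h : Integrable fun x => |u x| ^ (p + 1)) (hφ : IsTestFunction φ) :
    Integrable fun x => |u x| ^ (p - 1) * u x * φ x := by
  refine (h.add (hφ.integrable_abs_rpow (by linarith : 0 < p + 1))).mono' ?_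
    (.of_forall fun x => ?_)
  · have h1 : AEStronglyMeasurable fun x => |u x| ^ (p - 1) :=
      (Real.continuous_rpow_const (by linarith)).comp_aestronglyMeasurable hu.norm
    exact (h1.mul hu).mul hφ.1.continuous.aestronglyMeasurable
  · have e : |u x| ^ (p - 1) * |u x| = |u x| ^ p := by
      nth_rewrite 2 [← Real.rpow_one |u x|]
      rw [← Real.rpow_add_of_nonneg (abs_nonneg _) (by linarith) zero_le_one, sub_add_cancel]
    rw [Real.norm_eq_abs, abs_mul, abs_mul, abs_of_nonneg (Real.rpow_nonneg (abs_nonneg _) _), e]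
    exact rpow_mul_le_add (abs_nonneg _) (abs_nonneg _) (by linarith)

/-- Integrated tangent-line inequality. This one-sided bound replaces the derivative of the power
term, which enters the energy with a minus sign. -/
theorem integral_rpow_add_test_ge {u φ : EuclideanSpace ℝ (Fin N) → ℝ}
    (hu : AEStronglyMeasurable u) {p : ℝ} (hp : 1 < p)
    (h : Integrable fun x => |u x| ^ (p + 1)) (hφ : IsTestFunction φ) (t : ℝ) :
    (∫ x, |u x| ^ (p + 1)) + (p + 1) * t * (∫ x, |u x| ^ (p - 1) * u x * φ x)
      ≤ ∫ x, |u x + t * φ x| ^ (p + 1) := by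
  have i1 := (integrable_rpow_mul_test hu hp h hφ).const_mul ((p + 1) * t)
  rw [← integral_const_mul, ← integral_add h i1]
  refine integral_mono (h.add i1) ?_ fun x => ?_
  · refine integrable_abs_rpow_of_memLp (by linarith)
      ((memLp_of_integrable_abs_rpow hu (by linarith) h).add (MemLp.const_mul ?_ t))
    exact hφ.1.continuous.memLp_of_hasCompactSupport hφ.2
  · have := rpow_abs_add_ge (by linarith : 1 ≤ p + 1) (u x) (t * φ x)
    rw [show p + 1 - 2 = p - 1 by ring] at this
    linarith

/-! ### First variations along `u + tφ` -/

section Perturbation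

variable {u φ : EuclideanSpace ℝ (Fin N) → ℝ}
  {G : EuclideanSpace ℝ (Fin N) → EuclideanSpace ℝ (Fin N)}

theorem IsXPair.memLp_smul (h : IsXPair u G) : MemLp (fun x => u x • G x) 2 := by
  refine (memLp_two_iff_integrable_sq_norm (f := fun x => u x • G x)
    (h.2.1.1.smul h.2.2.1.1)).2 ?_
  simpa only [norm_smul, mul_pow, Real.norm_eq_abs] using h.2.2.2

theorem memLp_smul_add_smul (h : IsXPair u G) (hφ : IsTestFunction φ) :
    MemLp (fun x => u x • gradient φ x + φ x • G x) 2 := by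
  have h1 : MemLp φ ⊤ := hφ.1.continuous.memLp_of_hasCompactSupport hφ.2
  have h2 : MemLp (gradient φ) ⊤ :=
    hφ.continuous_gradient.memLp_of_hasCompactSupport hφ.hasCompactSupport_gradient
  exact (h2.smul (r := 2) h.2.1).add (h.2.2.1.smul (r := 2) h1)

theorem smul_add_test_eq (t : ℝ) (x : EuclideanSpace ℝ (Fin N)) :
    (u x + t * φ x) • (G x + t • gradient φ x)
      = u x • G x + t • (u x • gradient φ x + φ x • G x) + t ^ 2 • (φ x • gradient φ x) := by
  module

theorem IsXPair.add_test (h : IsXPair u G) (hφ : IsTestFunction φ) (t : ℝ) :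
    IsXPair (fun x => u x + t * φ x) (fun x => G x + t • gradient φ x) := by
  refine ⟨h.1.add_smul hφ.hasWeakGrad t, h.2.1.add (hφ.isXPair.2.1.const_mul t),
    h.2.2.1.add (hφ.isXPair.2.2.1.const_smul t), ?_⟩
  have h1 := (h.memLp_smul.add ((memLp_smul_add_smul h hφ).const_smul t)).add
    (hφ.isXPair.memLp_smul.const_smul (t ^ 2))
  refine ((memLp_two_iff_integrable_sq_norm h1.1).1 h1).congr (.of_forall fun x => ?_)
  simp only [Pi.add_apply, Pi.smul_apply]
  rw [← smul_add_test_eq, norm_smul, mul_pow, Real.norm_eq_abs]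

theorem hasDerivAt_mass (h : IsXPair u G) (hφ : IsTestFunction φ) :
    HasDerivAt (fun t : ℝ => ∫ x, |u x + t * φ x| ^ 2) (2 * ∫ x, u x * φ x) 0 := by
  have := hasDerivAt_integral_norm_sq h.2.1 hφ.isXPair.2.1 (MemLp.zero (p := 2))
  simpa [mul_comm] using this

theorem hasDerivAt_dirichlet (h : IsXPair u G) (hφ : IsTestFunction φ) :
    HasDerivAt (fun t : ℝ => ∫ x, ‖G x + t • gradient φ x‖ ^ 2)
      (2 * ∫ x, inner ℝ (G x) (gradient φ x)) 0 := by
  have := hasDerivAt_integral_norm_sq h.2.2.1 hφ.isXPair.2.2.1 (MemLp.zero (p := 2))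
  simpa using this

/-- The integrand is `‖(u + tφ)(G + t∇φ)‖²`, the squared norm of a quadratic curve in `L²`; this is
what the `t²` term of `hasDerivAt_integral_norm_sq` is for. -/
theorem hasDerivAt_quasilinear (h : IsXPair u G) (hφ : IsTestFunction φ) :
    HasDerivAt (fun t : ℝ => ∫ x, |u x + t * φ x| ^ 2 * ‖G x + t • gradient φ x‖ ^ 2)
      (2 * ∫ x, (u x * φ x * ‖G x‖ ^ 2 + |u x| ^ 2 * inner ℝ (G x) (gradient φ x))) 0 := by
  have := hasDerivAt_integral_norm_sq h.memLp_smul (memLp_smul_add_smul h hφ)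
    hφ.isXPair.memLp_smul
  simp only [← smul_add_test_eq, norm_smul, mul_pow, Real.norm_eq_abs] at this
  refine this.congr_deriv ?_
  congr 2
  ext x
  simp only [inner_add_right, inner_smul_left, inner_smul_right, real_inner_self_eq_norm_sq,
    conj_trivial, sq_abs]
  ring

end Perturbation

/-! ### The multiplier of a minimizer -/

theorem exists_test_integral_ne_zero {v : EuclideanSpace ℝ (Fin N) → ℝ} (hv : MemLp v 2)
    (h : ∫ x, |v x| ^ 2 ≠ 0) : ∃ φ, IsTestFunction φ ∧ ∫ x, v x * φ x ≠ 0 := by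
  by_contra! H
  have h0 : ∀ᵐ x, v x = 0 :=
    ae_eq_zero_of_integral_contDiff_smul_eq_zero (hv.locallyIntegrable (by norm_num))
      fun φ h1 h2 => by simpa [mul_comm] using H φ ⟨h1, h2⟩
  refine h (integral_eq_zero_of_ae ?_)
  filter_upwards [h0] with x hx
  simp [hx]

/-- A Lagrange multiplier of a minimizer `v` with `|v|^(p+1)` integrable is at most `2 J(v) / c`. -/
theorem multiplier_mul_mass_le (hN : 1 ≤ N) {p c β : ℝ} (hp : 1 < p) (hc : 0 < c)
    {v : EuclideanSpace ℝ (Fin N) → ℝ} (hv : IsGlobalMinimizer p c v)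
    (hw : IsWeakSolution p β v) (hD : Integrable fun x => |v x| ^ (p + 1)) :
    β * c ≤ 2 * energy p v := by
  have hX := isXPair_of_mem_spaceX hv.1.1
  have hmass : ∫ x, |v x| ^ 2 = c := hv.1.2
  obtain ⟨φ, hφ, hq⟩ := exists_test_integral_ne_zero hX.2.1 (hmass.trans_ne hc.ne')
  have hNR : (0 : ℝ) < N := by exact_mod_cast hN
  have hE := hX.energy_eq p
  have hEL := hw.2 φ hφ
  have dm := hasDerivAt_mass hX hφ
  have da := hasDerivAt_dirichlet hX hφ
  have db := hasDerivAt_quasilinear hX hφ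
  have hconv := integral_rpow_add_test_ge hX.2.1.1 hp hD hφ
  have hAnn : 0 ≤ ∫ x, ‖weakGrad v x‖ ^ 2 := integral_nonneg fun x => by positivity
  have hBnn : 0 ≤ ∫ x, |v x| ^ 2 * ‖weakGrad v x‖ ^ 2 := integral_nonneg fun x => by positivity
  set A := ∫ x, ‖weakGrad v x‖ ^ 2 with hA
  set B := ∫ x, |v x| ^ 2 * ‖weakGrad v x‖ ^ 2 with hB
  set D := ∫ x, |v x| ^ (p + 1)
  set q := ∫ x, v x * φ x
  set A' := ∫ x, inner ℝ (weakGrad v x) (gradient φ x)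
  set B' := ∫ x, (v x * φ x * ‖weakGrad v x‖ ^ 2
    + |v x| ^ 2 * inner ℝ (weakGrad v x) (gradient φ x))
  set D' := ∫ x, |v x| ^ (p - 1) * v x * φ x
  set m : ℝ → ℝ := fun t => ∫ x, |v x + t * φ x| ^ 2 with hm
  set a : ℝ → ℝ := fun t => ∫ x, ‖weakGrad v x + t • gradient φ x‖ ^ 2 with ha
  set b : ℝ → ℝ := fun t => ∫ x, |v x + t * φ x| ^ 2 * ‖weakGrad v x + t • gradient φ x‖ ^ 2
    with hb
  have m0 : m 0 = c := by simpa [hm] using hmass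
  have a0 : a 0 = A := by simp [ha, hA]
  have b0 : b 0 = B := by simp [hb, hB]
  set k : ℝ → ℝ := fun t => c / m t with hk
  -- A differentiable majorant of the energy of the rescaled perturbation: the power term is
  -- replaced by its tangent line. It equals `energy p v` at `t = 0`.
  set F : ℝ → ℝ := fun t => k t * (k t ^ (-(2 / N : ℝ)) * (1 / 2 * a t + b t)
    - 1 / (p + 1) * (D + (p + 1) * t * D')) with hF
  have k0 : k 0 = 1 := by rw [hk]; simp only [m0, div_self hc.ne']
  have dk : HasDerivAt k (-(2 * q) / c) 0 := by
    refine ((hasDerivAt_const (0 : ℝ) c).div dm (by rw [m0]; exact hc.ne')).congr_deriv ?_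
    rw [m0]
    field_simp
    ring
  have dF : HasDerivAt F (-(2 * q) / c * ((1 / 2 * A + B) - 1 / (p + 1) * D)
      + (-(2 * q) / c * -(2 / N) * (1 / 2 * A + B) + (A' + 2 * B') - D')) 0 := by
    have d1 := dk.rpow_const (p := -(2 / N : ℝ)) (.inl (by rw [k0]; exact one_ne_zero))
    have d2 := (((hasDerivAt_id (0 : ℝ)).const_mul (p + 1)).mul_const D').const_add D
    have d3 := dk.mul ((d1.mul ((da.const_mul (1 / 2)).add db)).sub (d2.const_mul (1 / (p + 1))))
    refine d3.congr_deriv ?_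
    have : p + 1 ≠ 0 := by linarith
    simp only [Pi.add_apply, Pi.mul_apply, Pi.sub_apply, k0, a0, b0, id, Real.one_rpow]
    field_simp
    ring
  have hmin : IsLocalMin F 0 := by
    have hpos : ∀ᶠ t in 𝓝 (0 : ℝ), 0 < m t :=
      dm.continuousAt.eventually_const_lt (by rw [m0]; exact hc)
    filter_upwards [hpos] with t ht
    have F0 : F 0 = energy p v := by
      rw [hE, hF]
      simp only [k0, a0, b0, Real.one_rpow]
      ring
    have kpos : 0 < k t := div_pos hc ht
    have ht' := hX.add_test hφ t
    -- Chosen so that `r^(-N) = c / m t`: the dilation brings the mass back to `c`.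
    set r : ℝ := k t ^ (-(1 / N : ℝ)) with hr
    have rpos : 0 < r := Real.rpow_pos_of_pos kpos _
    have rN : (r ^ N)⁻¹ = k t := by
      rw [hr, ← Real.rpow_natCast, ← Real.rpow_mul kpos.le, ← Real.rpow_neg kpos.le]
      rw [show -(-(1 / (N : ℝ)) * N) = 1 by field_simp, Real.rpow_one]
    have r2 : r ^ 2 = k t ^ (-(2 / N : ℝ)) := by
      rw [hr, ← Real.rpow_natCast, ← Real.rpow_mul kpos.le]
      congr 1
      push_cast
      ring
    have hmem := (ht'.dilate 1 rpos).mem_spaceX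
    have hms := integral_sq_dilate (fun x => v x + t * φ x) 1 rpos
    have hen := ht'.energy_dilate p zero_le_one rpos
    have hle : energy p v ≤ energy p _ := hv.2 (show _ ∈ massSphere N c from ⟨hmem, hms.trans (by
      rw [rN]; simp only [hk, one_pow, one_mul]; exact div_mul_cancel₀ c ht.ne')⟩)
    rw [hen, rN, r2] at hle
    rw [F0]
    refine hle.trans ?_
    simp only [hF, one_pow, one_mul, Real.one_rpow]
    have hp1 : 0 ≤ 1 / (p + 1) := by
      have : 0 < p + 1 := by linarith
      positivity
    refine mul_le_mul_of_nonneg_left ?_ kpos.le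
    have := mul_le_mul_of_nonneg_left (hconv t) hp1
    rw [mul_add (k t ^ (-(2 / N : ℝ)))]
    linarith
  have hzero := hmin.hasDerivAt_eq_zero dF
  -- `F'(0) = 0`, with the weak equation in the form `A' + 2B' - D' = βq`.
  have key : q * (β * c) = q * (2 * energy p v - 4 / N * (1 / 2 * A + B)) := by
    rw [hE]
    have h1 : A' + 2 * B' - D' = β * q := by linarith
    have h2 : (A' + 2 * B' - D') * c = 2 * q * ((1 / 2 * A + B) - 1 / (p + 1) * D)
        - 2 * q * (2 / N) * (1 / 2 * A + B) := by
      have h3 : A' + 2 * B' - D' = -(-(2 * q) / c * ((1 / 2 * A + B) - 1 / (p + 1) * D)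
        + (-(2 * q) / c * -(2 / N) * (1 / 2 * A + B))) := by linarith
      rw [h3]
      generalize 1 / (p + 1) * D = Y
      field_simp
      ring
    rw [h1] at h2
    linear_combination h2
  have := mul_left_cancel₀ hq key
  rw [this]
  have : 0 ≤ 4 / (N : ℝ) * (1 / 2 * A + B) := by positivity
  linarith

/-! ### Trial functions of very negative energy -/

theorem exists_bump (N : ℕ) : ∃ w : EuclideanSpace ℝ (Fin N) → ℝ, IsTestFunction w ∧
    ∀ q : ℝ, 0 < q → 0 < ∫ x, |w x| ^ q := by
  let w : ContDiffBump (0 : EuclideanSpace ℝ (Fin N)) := default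
  refine ⟨w, ⟨w.contDiff, w.hasCompactSupport⟩, fun q hq => ?_⟩
  have hc : Continuous fun x => |w x| ^ q :=
    (Real.continuous_rpow_const hq.le).comp w.continuous.abs
  refine hc.integral_pos_of_hasCompactSupport_nonneg_nonzero (x := 0) ?_
    (fun x => by positivity) ?_
  · exact w.hasCompactSupport.comp_left (g := fun t : ℝ => |t| ^ q) (by simp [hq.ne'])
  · have : 0 < w 0 := w.pos_of_mem_ball (Metric.mem_ball_self w.rOut_pos)
    positivity

/-- The minimal energy on `S(c)` is at most `K c` for every real `K`, once `c` is large. -/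
theorem exists_energy_le_mul (N : ℕ) {p : ℝ} (hp : 1 < p) (K : ℝ) :
    ∃ C : ℝ, 0 < C ∧ ∀ c : ℝ, C ≤ c → ∃ u ∈ massSphere N c, energy p u ≤ K * c := by
  obtain ⟨w, hw, hpos⟩ := exists_bump N
  have hX := hw.isXPair
  have hW : 0 < ∫ x, |w x| ^ 2 := by simpa using hpos 2 two_pos
  have hD := hpos (p + 1) (by linarith)
  have hE : ∀ R : ℝ, 0 < R → _ := fun R hR => hX.energy_dilate p hR.le (inv_pos.2 hR)
  have hM : ∀ R : ℝ, 0 < R → _ := fun R hR => integral_sq_dilate w R (inv_pos.2 hR)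
  have hAnn : 0 ≤ 1 / 2 * ∫ x, ‖gradient w x‖ ^ 2 :=
    mul_nonneg (by norm_num) (integral_nonneg fun x => by positivity)
  set W := ∫ x, |w x| ^ 2
  set A := 1 / 2 * ∫ x, ‖gradient w x‖ ^ 2
  set B := ∫ x, |w x| ^ 2 * ‖gradient w x‖ ^ 2
  have hD' : 0 < 1 / (p + 1) * ∫ x, |w x| ^ (p + 1) :=
    mul_pos (one_div_pos.2 (by linarith)) hD
  set D := 1 / (p + 1) * ∫ x, |w x| ^ (p + 1)
  have hlim : Tendsto (fun R : ℝ => R ^ (p - 1) * D) atTop atTop :=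
    (tendsto_rpow_atTop (by linarith : 0 < p - 1)).atTop_mul_const hD'
  obtain ⟨R₀, hR₀⟩ := (hlim.eventually_ge_atTop (A + B - K * W)).exists_forall_of_atTop
  set R₁ := max R₀ 1
  have hR₁ : 1 ≤ R₁ := le_max_right _ _
  -- The mass of `R w(x/R)` is `R^(N+2) W`, so this threshold forces `R ≥ R₁`. Then `R ≥ R₀` makes
  -- the power term win, and `R ≥ 1` gives `A ≤ R² A`.
  refine ⟨R₁ ^ (N + 2) * W, by positivity, fun c hc => ?_⟩
  have hcW : R₁ ^ (N + 2) ≤ c / W := (le_div_iff₀ hW).2 hc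
  have hcW0 : 0 ≤ c / W := le_trans (by positivity) hcW
  set R : ℝ := (c / W) ^ (((N + 2 : ℕ) : ℝ)⁻¹)
  have hRN : R ^ (N + 2) = c / W := Real.rpow_inv_natCast_pow hcW0 (by omega)
  have hRR : R₁ ≤ R := by
    have hRnn : 0 ≤ R := Real.rpow_nonneg hcW0 _
    exact (pow_le_pow_iff_left₀ (by linarith) hRnn (by omega : N + 2 ≠ 0)).1 (by rwa [hRN])
  have hR1 : 1 ≤ R := hR₁.trans hRR
  have hR : 0 < R := by linarith
  have hRc : R ^ N * R ^ 2 * W = c := by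
    rw [← pow_add, hRN, div_mul_cancel₀ _ hW.ne']
  refine ⟨fun x => R * w (R⁻¹ • x), ⟨(hX.dilate R (inv_pos.2 hR)).mem_spaceX, ?_⟩, ?_⟩
  · rw [hM R hR, inv_pow, inv_inv, ← mul_assoc, hRc]
  · rw [hE R hR, inv_pow, inv_inv, ← hRc]
    have e : R ^ (p + 1) = R ^ 2 * R ^ (p - 1) := by
      rw [← Real.rpow_two, ← Real.rpow_add hR]
      congr 1
      ring
    have h1 := hR₀ R ((le_max_left _ _).trans hRR)
    have h2 : R ^ 2 * R⁻¹ ^ 2 = 1 := by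
      rw [← mul_pow, mul_inv_cancel₀ hR.ne', one_pow]
    have h3 : R ^ 4 * R⁻¹ ^ 2 = R ^ 2 := by
      rw [show R ^ 4 = R ^ 2 * R ^ 2 by ring, mul_assoc, h2, mul_one]
    rw [e, h2, h3]
    have h4 : A ≤ R ^ 2 * A := le_mul_of_one_le_left hAnn (one_le_pow₀ hR1)
    have h5 : R ^ 2 * (A + B - K * W) ≤ R ^ 2 * (R ^ (p - 1) * D) :=
      mul_le_mul_of_nonneg_left h1 (by positivity)
    have h6 : 1 * A + R ^ 2 * B - R ^ 2 * R ^ (p - 1) * D ≤ R ^ 2 * (K * W) := by linarith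
    calc _ ≤ R ^ N * (R ^ 2 * (K * W)) := mul_le_mul_of_nonneg_left h6 (by positivity)
      _ = _ := by ring

/-- A divergent power integral has the default value `0`, which would leave a nonnegative energy. No
Sobolev embedding is needed. -/
theorem integrable_of_energy_neg {p : ℝ} {v : EuclideanSpace ℝ (Fin N) → ℝ}
    (h : energy p v < 0) : Integrable fun x => |v x| ^ (p + 1) := by
  by_contra hn
  have hA : 0 ≤ ∫ x, ‖weakGrad v x‖ ^ 2 := integral_nonneg fun x => by positivity
  have hB : 0 ≤ ∫ x, |v x| ^ 2 * ‖weakGrad v x‖ ^ 2 := integral_nonneg fun x => by positivity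
  rw [energy, integral_undef hn] at h
  linarith

end QuasilinearSchrodinger

theorem mainTheorem3 (N : ℕ) (hN : 1 ≤ N) (p : ℝ) (hp : 1 < p) (hp' : p < 3 + 4 / (N : ℝ)) :
    ∀ M : ℝ, ∃ C : ℝ, 0 < C ∧ ∀ c : ℝ, C ≤ c →
      ∀ (v : EuclideanSpace ℝ (Fin N) → ℝ) (β : ℝ),
        QuasilinearSchrodinger.IsGlobalMinimizer p c v →
        QuasilinearSchrodinger.IsLagrangeMultiplier p c v β →
        β < M := by
  intro M
  -- The bound `-1` makes the energy negative, hence the power integrable; `M / 2 - 1` gives `β ≤ M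
  -- - 2`.
  obtain ⟨C, hC, h⟩ := QuasilinearSchrodinger.exists_energy_le_mul N hp (min (M / 2 - 1) (-1))
  refine ⟨C, hC, fun c hc v β hv hβ => ?_⟩
  obtain ⟨u, hu, hle⟩ := h c hc
  have hc0 : 0 < c := hC.trans_le hc
  have hJ : QuasilinearSchrodinger.energy p v ≤ min (M / 2 - 1) (-1) * c := (hv.2 hu).trans hle
  have h1 : min (M / 2 - 1) (-1) * c ≤ (M / 2 - 1) * c :=
    mul_le_mul_of_nonneg_right (min_le_left _ _) hc0.le
  have h2 : min (M / 2 - 1) (-1) * c ≤ -1 * c :=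
    mul_le_mul_of_nonneg_right (min_le_right _ _) hc0.le
  have h3 := QuasilinearSchrodinger.multiplier_mul_mass_le hN hp hc0 hv hβ.2
    (QuasilinearSchrodinger.integrable_of_energy_neg (by linarith))
  nlinarith
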